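/- Let $c:[0,\infty)\to\mathbb R$ be Lebesgue measurable with $\int_0^t|c(u)|\,du<\infty$ for all $t\ge 0$, and let $\tau:[0,\infty)\to\mathbb R$ be Lebesgue measurable with $\tau(t)\le t$ for all $t\ge 0$ and $\lim_{t\to\infty}\tau(t)=\infty$; no sign condition is imposed on $c$. Put $\tau_{\min}(t)=\inf_{v\ge t}\tau(v)$ for $t\ge0$. Let $t_1\ge 0$ satisfy $\tau_{\min}(t_1)>0$ and let $\rho>\inf\{t>0:\tau_{\min}(t)>t_1\}$. For $t_0\ge\rho$, a solution of $$x'(t)+c(t)\,x(\tau(t))=0 \qquad (1)$$ is a function $x:[\tau_{\min}(t_0),\infty)\to\mathbb R$ that is absolutely continuous on every compact interval $[\tau_{\min}(t_0),b]$ and satisfies (1) for almost every $t\ge t_0$. For $\ell\in[0,\infty)$, a function $x:[a,\infty)\to\mathbb R$ (where $a\ge0$) is called $\ell$-rapidly oscillating if it has arbitrarily large zeros and there is $T\ge a$ such that for all $A,B\in[T,\infty)$ with $A<B$: if $x(v)\ne0$ for all $v\in(A,B)$, then $\int_A^B|c(v)|\,dv\le\ell$. For $s\in[1,2]$ let $$\Lambda(s)=2+s-\sqrt{2s}-\ln\bigl(\sqrt{2s}-1\bigr).$$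 Theorem. Let $s\in[1,2]$ and $\ell\ge 0$ be such that $$\sup_{t\ge\rho}\int_{\tau(t)}^t|c(\zeta)|\,d\zeta\le s,\qquad \ell\le\Lambda(s).$$ Then every $\ell$-rapidly oscillating solution of (1) is bounded. If moreover $\ell<\Lambda(s)$, then every $\ell$-rapidly oscillating solution $x$ of (1) satisfies $\lim_{t\to\infty}x(t)=0$. -/

import Mathlib

open MeasureTheory Filter Set Topology

noncomputable section

namespace DelayEq

/-- Standing assumptions on the coefficient `c` and the delayed argument `τ`; both are functions
on `[0, ∞)`, so only their values on `[0, ∞)` are constrained. -/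
structure IsData (c τ : ℝ → ℝ) : Prop where
  /-- `c` is Lebesgue measurable with `∫₀ᵗ |c| < ∞` for every `t ≥ 0`. -/
  integrableOn : ∀ t : ℝ, 0 ≤ t → IntegrableOn c (Icc 0 t) volume
  /-- `τ` is Lebesgue measurable on `[0, ∞)`. -/
  measurable : AEMeasurable τ (volume.restrict (Ici 0))
  le_self : ∀ t : ℝ, 0 ≤ t → τ t ≤ t
  tendsto : Tendsto τ atTop atTop

/-- `τ_min(t) = inf_{v ≥ t} τ(v)`. If `τ` is unbounded below on `[t, ∞)` (true infimum `-∞`), this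
real infimum takes the value `0`; below, `tauMin` matters only at points where it is required to
exceed a number that is `≥ 0` (or at larger points), and there the infimum is a genuine one. -/
def tauMin (τ : ℝ → ℝ) (t : ℝ) : ℝ := sInf (τ '' Ici t)

/-- `ρ` is admissible: `ρ > inf {t > 0 : τ_min(t) > t₁}` for some `t₁ ≥ 0` with
`τ_min(t₁) > 0`. -/
def IsAdmissible (τ : ℝ → ℝ) (ρ : ℝ) : Prop :=
  ∃ t₁ : ℝ, 0 ≤ t₁ ∧ 0 < tauMin τ t₁ ∧ sInf {t : ℝ | 0 < t ∧ t₁ < tauMin τ t} < ρ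

/-- `x : [τ_min(t₀), ∞) → ℝ` solves `x'(t) + c(t) x(τ(t)) = 0`: it is absolutely continuous on
every compact subinterval `[τ_min(t₀), b]` and satisfies the equation at almost every `t ≥ t₀`.
Only the values of `x` on `[τ_min(t₀), ∞)` matter. -/
structure IsSolution (c τ : ℝ → ℝ) (t₀ : ℝ) (x : ℝ → ℝ) : Prop where
  absolutelyContinuous : ∀ b : ℝ, tauMin τ t₀ ≤ b →
    AbsolutelyContinuousOnInterval x (tauMin τ t₀) b
  equation : ∀ᵐ t ∂(volume.restrict (Ici t₀)), HasDerivAt x (-(c t * x (τ t))) t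

/-- `x : [a, ∞) → ℝ` is `ℓ`-rapidly oscillating (with respect to the coefficient `c`). -/
structure IsRapidlyOscillating (c : ℝ → ℝ) (ℓ a : ℝ) (x : ℝ → ℝ) : Prop where
  nonneg : 0 ≤ ℓ
  zeros : ∀ T : ℝ, ∃ t : ℝ, T ≤ t ∧ a ≤ t ∧ x t = 0
  integral_le : ∃ t₁ : ℝ, a ≤ t₁ ∧ ∀ A B : ℝ, t₁ ≤ A → A < B →
    (∀ v ∈ Ioo A B, x v ≠ 0) → ∫ v in A..B, |c v| ≤ ℓ

/-- `Λ(s) = 2 + s - √(2s) - ln(√(2s) - 1)`, used for `s ∈ [1, 2]` only. -/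
def Lam (s : ℝ) : ℝ := 2 + s - √(2 * s) - Real.log (√(2 * s) - 1)

end DelayEq

end

open MeasureTheory Filter Set Topology

namespace DelayEq

/-! Time is measured by `w = ∫ |c|`, so that a solution moves at speed at most `|x(τ t)|`. Let `|x|
≤ M` on the relevant history and let `A` be a zero. At weighted time `w` after `A` there are two
cases. If `τ t < A`, then `A` is at weighted distance at most `s - w` from `τ t`, so `|x(τ t)| ≤ M
min(1, s - w)`. If `τ t ≥ A`, the bound already reached after `A` applies. The extremal profile is
`growth s`, which first reaches 1 at `w = Λ(s) - 1` (`growth_Lam_sub_one`), and `abs_le_mul_growth`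
proves the comparison.

Descending from a maximum to the next zero costs weight at least 1. An arc between consecutive zeros
that exceeds `M` therefore has weight greater than `Λ(s)`, which is excluded when `ℓ ≤ Λ(s)`; this
gives boundedness (`exists_forall_abs_le`). If `ℓ < Λ(s)`, the slack is split between ascent and
descent, and eventual bounds shrink by a fixed factor (`exists_contraction`). -/

/-! ### Comparison of increments for absolutely continuous functions. -/

/-- A Lipschitz function of an absolutely continuous function is absolutely continuous. -/
theorem _root_.LipschitzOnWith.comp_absolutelyContinuousOnInterval {φ w : ℝ → ℝ} {K : NNReal}
    {S : Set ℝ} {a b : ℝ} (hφ : LipschitzOnWith K φ S) (hw : AbsolutelyContinuousOnInterval w a b)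
    (hmaps : MapsTo w (uIcc a b) S) : AbsolutelyContinuousOnInterval (fun t ↦ φ (w t)) a b := by
  have h := Tendsto.const_mul (K : ℝ) hw
  rw [mul_zero] at h
  refine squeeze_zero' ?_ ?_ h
  · exact Eventually.of_forall fun E ↦ Finset.sum_nonneg fun _ _ ↦ dist_nonneg
  · have : ∀ᶠ E in AbsolutelyContinuousOnInterval.totalLengthFilter ⊓
        𝓟 (AbsolutelyContinuousOnInterval.disjWithin a b),
        E ∈ AbsolutelyContinuousOnInterval.disjWithin a b :=
      eventually_inf_principal.mpr (by simp)
    filter_upwards [this] with E hE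
    rw [Finset.mul_sum]
    refine Finset.sum_le_sum fun i hi ↦ ?_
    exact hφ.dist_le_mul _ (hmaps (hE.1 i hi).1) _ (hmaps (hE.1 i hi).2)

/-- If `|x'| ≤ |c| φ'(w)` almost everywhere, where `w = ∫ |c|`, then the increments of `x` are
dominated by those of `φ ∘ w`. -/
theorem abs_sub_le_of_abs_deriv_le {c x φ φ' : ℝ → ℝ} {a b : ℝ} (hab : a ≤ b)
    (hc : IntervalIntegrable c volume a b) (hx : AbsolutelyContinuousOnInterval x a b)
    (hφ : ∀ v, HasDerivAt φ (φ' v) v) (hφ' : Continuous φ')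
    (hd : ∀ᵐ t, t ∈ Ioo a b → ∃ d, HasDerivAt x d t ∧ |d| ≤ |c t| * φ' (∫ u in a..t, |c u|)) :
    |x b - x a| ≤ φ (∫ u in a..b, |c u|) - φ 0 := by
  set w : ℝ → ℝ := fun t ↦ ∫ u in a..t, |c u| with hw
  have hwac : AbsolutelyContinuousOnInterval w a b :=
    hc.abs.absolutelyContinuousOnInterval_intervalIntegral left_mem_uIcc
  have hφC : ContDiff ℝ 1 φ := by
    rw [contDiff_one_iff_deriv]
    refine ⟨fun v ↦ (hφ v).differentiableAt, ?_⟩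
    have : deriv φ = φ' := funext fun v ↦ (hφ v).deriv
    rwa [this]
  -- `φ` is only locally Lipschitz, so a compact interval containing the range of `w` is fixed.
  obtain ⟨R, hR⟩ := hwac.exists_bound
  obtain ⟨K, hK⟩ := hφC.contDiffOn.exists_lipschitzOnWith (s := Icc (-R) R) (by decide)
    (convex_Icc _ _) isCompact_Icc
  have hFac : AbsolutelyContinuousOnInterval (fun t ↦ φ (w t)) a b :=
    hK.comp_absolutelyContinuousOnInterval hwac fun t ht ↦ by
      have := hR t ht
      rw [Real.norm_eq_abs] at this
      exact abs_le.mp this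
  have hFd : ∀ᵐ t, t ∈ uIcc a b → HasDerivAt (fun t ↦ φ (w t)) (φ' (w t) * |c t|) t := by
    filter_upwards [hc.abs.ae_hasDerivAt_integral] with t ht htab
    exact (hφ (w t)).comp t (ht htab a left_mem_uIcc)
  have hle : ∀ᵐ t ∂volume.restrict (Ioc a b), ‖deriv x t‖ ≤ deriv (fun t ↦ φ (w t)) t := by
    rw [← Measure.restrict_congr_set Ioo_ae_eq_Ioc, ae_restrict_iff' measurableSet_Ioo]
    filter_upwards [hFd, hd] with t h1 h2 ht
    obtain ⟨d, hd1, hd2⟩ := h2 ht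
    rw [hd1.deriv, (h1 (by rw [uIcc_of_le hab]; exact Ioo_subset_Icc_self ht)).deriv,
      Real.norm_eq_abs, mul_comm]
    exact hd2
  have h0 : φ (w a) = φ 0 := by simp [hw]
  rw [← h0, ← hFac.integral_deriv_eq_sub, ← hx.integral_deriv_eq_sub]
  rw [← Real.norm_eq_abs]
  exact intervalIntegral.norm_integral_le_of_norm_le hab
    ((ae_restrict_iff' measurableSet_Ioc).mp hle) hFac.intervalIntegrable_deriv

/-- Linear case of `abs_sub_le_of_abs_deriv_le`, for the delay equation. -/
theorem abs_sub_le_mul_integral {c τ x : ℝ → ℝ} {a b M : ℝ} (hab : a ≤ b)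
    (hc : IntervalIntegrable c volume a b) (hx : AbsolutelyContinuousOnInterval x a b)
    (heq : ∀ᵐ t, t ∈ Icc a b → HasDerivAt x (-(c t * x (τ t))) t)
    (hM : ∀ t ∈ Icc a b, |x (τ t)| ≤ M) :
    |x b - x a| ≤ M * ∫ u in a..b, |c u| := by
  have := abs_sub_le_of_abs_deriv_le (φ := fun v ↦ M * v) (φ' := fun _ ↦ M) hab hc hx
    (fun v ↦ by simpa using (hasDerivAt_id v).const_mul M) continuous_const ?_
  · simpa using this
  · filter_upwards [heq] with t ht htab
    refine ⟨_, ht (Ioo_subset_Icc_self htab), ?_⟩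
    rw [abs_neg, abs_mul]
    exact mul_le_mul_of_nonneg_left (hM t (Ioo_subset_Icc_self htab)) (abs_nonneg _)

/-! ### The extremal growth profile. -/

/-- The largest possible speed of a normalized solution at (weighted) time `w` after a zero. -/
noncomputable def growthRate (s w : ℝ) : ℝ :=
  max (min 1 (s - w)) ((√(2 * s) - 1) * Real.exp (w - (s - (√(2 * s) - 1))))

/-- The largest possible value of a normalized solution at (weighted) time `w` after a zero. -/
noncomputable def growth (s w : ℝ) : ℝ := ∫ v in (0 : ℝ)..w, growthRate s v

theorem sqrt_two_mul_sub_one_pos {s : ℝ} (hs : 1 ≤ s) : 0 < √(2 * s) - 1 := by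
  have : 1 < √(2 * s) := Real.lt_sqrt_of_sq_lt (by linarith)
  linarith

theorem sqrt_two_mul_sub_one_le_one {s : ℝ} (hs : s ≤ 2) : √(2 * s) - 1 ≤ 1 := by
  have : √(2 * s) ≤ 2 := Real.sqrt_le_iff.mpr ⟨by norm_num, by linarith⟩
  linarith

theorem continuous_growthRate (s : ℝ) : Continuous (growthRate s) := by
  unfold growthRate
  fun_prop

theorem hasDerivAt_growth (s w : ℝ) : HasDerivAt (growth s) (growthRate s w) w :=
  intervalIntegral.integral_hasDerivAt_right ((continuous_growthRate s).intervalIntegrable _ _)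
    ((continuous_growthRate s).stronglyMeasurableAtFilter _ _) (continuous_growthRate s).continuousAt

theorem growth_zero (s : ℝ) : growth s 0 = 0 := by simp [growth]

theorem growthRate_pos {s : ℝ} (hs : 1 ≤ s) (w : ℝ) : 0 < growthRate s w :=
  lt_max_of_lt_right (mul_pos (sqrt_two_mul_sub_one_pos hs) (Real.exp_pos _))

theorem strictMono_growth {s : ℝ} (hs : 1 ≤ s) : StrictMono (growth s) :=
  strictMono_of_deriv_pos fun w ↦ by
    rw [(hasDerivAt_growth s w).deriv]
    exact growthRate_pos hs w

theorem growthRate_of_le {s w : ℝ} (hs : s ∈ Icc (1 : ℝ) 2) (hw : w ≤ s - (√(2 * s) - 1)) :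
    growthRate s w = min 1 (s - w) := by
  have h1 := sqrt_two_mul_sub_one_pos hs.1
  have h2 := sqrt_two_mul_sub_one_le_one hs.2
  refine max_eq_left ?_
  have : Real.exp (w - (s - (√(2 * s) - 1))) ≤ 1 := Real.exp_le_one_iff.mpr (by linarith)
  refine le_trans (mul_le_of_le_one_right h1.le this) (le_min h2 (by linarith))

theorem growthRate_of_ge {s w : ℝ} (hs : 1 ≤ s) (hw : s - (√(2 * s) - 1) ≤ w) :
    growthRate s w = (√(2 * s) - 1) * Real.exp (w - (s - (√(2 * s) - 1))) := by
  have h1 := sqrt_two_mul_sub_one_pos hs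
  refine max_eq_right ((min_le_right _ _).trans ?_)
  have : 1 ≤ Real.exp (w - (s - (√(2 * s) - 1))) := Real.one_le_exp (by linarith)
  nlinarith

/-- Write `κ = √(2s) - 1`. Unit speed up to `s - 1`, then speed `s - v` up to `s - κ`, gives the
value `(s - 1) + (1 - κ²)/2`. It equals `κ` because `(κ + 1)² = 2s`. Value and speed thus agree at
the transition, and from there the profile solves `g' = g`. -/
theorem growth_transition {s : ℝ} (hs : s ∈ Icc (1 : ℝ) 2) :
    growth s (s - (√(2 * s) - 1)) = √(2 * s) - 1 := by
  have h1 := sqrt_two_mul_sub_one_pos hs.1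
  have h2 := sqrt_two_mul_sub_one_le_one hs.2
  have hsq : √(2 * s) ^ 2 = 2 * s := Real.sq_sqrt (by linarith [hs.1])
  have hi : ∀ a b, IntervalIntegrable (growthRate s) volume a b :=
    fun a b ↦ (continuous_growthRate s).intervalIntegrable _ _
  rw [growth, ← intervalIntegral.integral_add_adjacent_intervals (hi 0 (s - 1)) (hi _ _)]
  have e1 : ∫ v in (0 : ℝ)..(s - 1), growthRate s v = ∫ v in (0 : ℝ)..(s - 1), (1 : ℝ) := by
    refine intervalIntegral.integral_congr fun v hv ↦ ?_
    rw [uIcc_of_le (by linarith [hs.1])] at hv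
    rw [growthRate_of_le hs (by linarith [hv.2]), min_eq_left (by linarith [hv.2])]
  have e2 : ∫ v in (s - 1)..(s - (√(2 * s) - 1)), growthRate s v
      = ∫ v in (s - 1)..(s - (√(2 * s) - 1)), (s - v) := by
    refine intervalIntegral.integral_congr fun v hv ↦ ?_
    rw [uIcc_of_le (by linarith)] at hv
    rw [growthRate_of_le hs hv.2, min_eq_right (by linarith [hv.1])]
  rw [e1, e2, intervalIntegral.integral_sub (by simp) (by simp)]
  simp only [intervalIntegral.integral_const, integral_id, smul_eq_mul]
  nlinarith

theorem growth_of_ge {s w : ℝ} (hs : s ∈ Icc (1 : ℝ) 2) (hw : s - (√(2 * s) - 1) ≤ w) :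
    growth s w = (√(2 * s) - 1) * Real.exp (w - (s - (√(2 * s) - 1))) := by
  have hi : ∀ a b, IntervalIntegrable (growthRate s) volume a b :=
    fun a b ↦ (continuous_growthRate s).intervalIntegrable _ _
  rw [growth, ← intervalIntegral.integral_add_adjacent_intervals
    (hi 0 (s - (√(2 * s) - 1))) (hi _ _)]
  have e0 := growth_transition hs
  rw [growth] at e0
  have e1 : ∫ v in (s - (√(2 * s) - 1))..w, growthRate s v
      = (√(2 * s) - 1) * Real.exp (w - (s - (√(2 * s) - 1)))
        - (√(2 * s) - 1) * Real.exp ((s - (√(2 * s) - 1)) - (s - (√(2 * s) - 1))) := by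
    refine intervalIntegral.integral_eq_sub_of_hasDerivAt (f := fun v ↦
      (√(2 * s) - 1) * Real.exp (v - (s - (√(2 * s) - 1)))) (fun v hv ↦ ?_) (hi _ _)
    rw [uIcc_of_le hw] at hv
    rw [growthRate_of_ge hs.1 hv.1]
    simpa using (((hasDerivAt_id v).sub_const (s - (√(2 * s) - 1))).exp.const_mul (√(2 * s) - 1))
  rw [e0, e1, sub_self, Real.exp_zero]
  ring

/-- This lets one rate cover both positions of the delayed argument: a value taken after the zero is
at most the current profile value, hence at most the current speed. -/
theorem growth_le_growthRate {s w : ℝ} (hs : s ∈ Icc (1 : ℝ) 2) :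
    growth s w ≤ growthRate s w := by
  rcases le_total w (s - (√(2 * s) - 1)) with hw | hw
  · calc growth s w ≤ growth s (s - (√(2 * s) - 1)) := (strictMono_growth hs.1).monotone hw
      _ = √(2 * s) - 1 := growth_transition hs
      _ ≤ min 1 (s - w) := le_min (sqrt_two_mul_sub_one_le_one hs.2) (by linarith)
      _ = growthRate s w := (growthRate_of_le hs hw).symm
  · rw [growth_of_ge hs hw, growthRate_of_ge hs.1 hw]

theorem growth_Lam_sub_one {s : ℝ} (hs : s ∈ Icc (1 : ℝ) 2) : growth s (Lam s - 1) = 1 := by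
  have h1 := sqrt_two_mul_sub_one_pos hs.1
  have h2 := sqrt_two_mul_sub_one_le_one hs.2
  have hlog : Real.log (√(2 * s) - 1) ≤ 0 := Real.log_nonpos h1.le h2
  have e : Lam s - 1 - (s - (√(2 * s) - 1)) = -Real.log (√(2 * s) - 1) := by
    rw [Lam]; ring
  rw [growth_of_ge hs (by linarith), e, Real.exp_neg, Real.exp_log h1, mul_inv_cancel₀ h1.ne']

/-! ### Growth after a zero, and arcs between zeros. -/

/-- A solution with history bounded by `M` grows after a zero at most like `M * growth s`. -/
theorem abs_le_mul_growth {c τ x : ℝ → ℝ} {s A' A m M : ℝ} (hs : s ∈ Icc (1 : ℝ) 2)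
    (hA'A : A' ≤ A) (hAm : A ≤ m) (hM0 : 0 ≤ M)
    (hc : IntervalIntegrable c volume A' m) (hx : AbsolutelyContinuousOnInterval x A' m)
    (heq : ∀ᵐ t, t ∈ Icc A' m → HasDerivAt x (-(c t * x (τ t))) t)
    (hτ : ∀ t ∈ Icc A m, A' ≤ τ t) (hτt : ∀ t ∈ Icc A m, τ t ≤ t)
    (hM : ∀ t ∈ Icc A' m, |x (τ t)| ≤ M)
    (hsup : ∀ t ∈ Icc A m, ∫ u in (τ t)..t, |c u| ≤ s) (hxA : x A = 0) :
    |x m| ≤ M * growth s (∫ u in A..m, |c u|) := by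
  have hci : ∀ p q, A' ≤ p → p ≤ q → q ≤ m → IntervalIntegrable c volume p q := by
    intro p q h1 h2 h3
    refine hc.mono_set ?_
    rw [uIcc_of_le h2, uIcc_of_le (by linarith)]
    exact Icc_subset_Icc h1 h3
  have hxi : ∀ p q, A' ≤ p → p ≤ q → q ≤ m → AbsolutelyContinuousOnInterval x p q := by
    intro p q h1 h2 h3
    refine hx.mono ?_
    rw [uIcc_of_le h2, uIcc_of_le (by linarith)]
    exact Icc_subset_Icc h1 h3
  set w : ℝ → ℝ := fun t ↦ ∫ u in A..t, |c u| with hw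
  have hwmono : ∀ p q, A ≤ p → p ≤ q → q ≤ m → w p ≤ w q := by
    intro p q h1 h2 h3
    have := intervalIntegral.integral_add_adjacent_intervals (hci A p hA'A h1 (by linarith)).abs
      (hci p q (by linarith) h2 h3).abs
    have h0 : 0 ≤ ∫ u in p..q, |c u| :=
      intervalIntegral.integral_nonneg h2 fun _ _ ↦ abs_nonneg _
    simp only [hw]
    linarith
  have hwcont : ContinuousOn w (Icc A m) := by
    have := ((hci A m hA'A hAm le_rfl).abs.absolutelyContinuousOnInterval_intervalIntegral
      (c := A) left_mem_uIcc).continuousOn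
    rwa [uIcc_of_le hAm] at this
  have hxcont : ContinuousOn x (Icc A m) := by
    have := (hxi A m hA'A hAm le_rfl).continuousOn
    rwa [uIcc_of_le hAm] at this
  -- The term `ε * exp` makes the comparison strict: it preserves "value ≤ speed" and starts at `ε >
  -- 0`. Up to a first contact time `t₁` the increment bound gives `|x t₁| ≤ φ (w t₁) - ε`, a
  -- contradiction.
  have key : ∀ ε > 0, ∀ t ∈ Icc A m, |x t| < M * growth s (w t) + ε * Real.exp (w t) := by
    intro ε hε
    set φ : ℝ → ℝ := fun v ↦ M * growth s v + ε * Real.exp v with hφ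
    have hφd : ∀ v, HasDerivAt φ (M * growthRate s v + ε * Real.exp v) v := fun v ↦
      ((hasDerivAt_growth s v).const_mul M).add ((Real.hasDerivAt_exp v).const_mul ε)
    have hφc : Continuous φ := continuous_iff_continuousAt.mpr fun v ↦ (hφd v).continuousAt
    have hφm : Monotone φ := fun p q hpq ↦ add_le_add
      (mul_le_mul_of_nonneg_left ((strictMono_growth hs.1).monotone hpq) hM0)
      (mul_le_mul_of_nonneg_left (Real.exp_le_exp.mpr hpq) hε.le)
    by_contra! hcon
    obtain ⟨t', ht', hbad'⟩ := hcon
    have hclosed : IsCompact (Icc A m ∩ {t | φ (w t) ≤ |x t|}) := by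
      refine isCompact_Icc.of_isClosed_subset ?_ inter_subset_left
      exact isClosed_Icc.isClosed_le (hφc.comp_continuousOn hwcont) hxcont.abs
    obtain ⟨t₁, ⟨ht₁, hbad⟩, hleast⟩ := hclosed.exists_isLeast ⟨t', ht', hbad'⟩
    have hgood : ∀ t, A ≤ t → t < t₁ → |x t| ≤ φ (w t) := by
      intro t h1 h2
      by_contra! h
      exact absurd (hleast ⟨⟨h1, h2.le.trans ht₁.2⟩, h.le⟩) (not_le.mpr h2)
    have := abs_sub_le_of_abs_deriv_le (c := c) (x := x) ht₁.1 (hci A t₁ hA'A ht₁.1 ht₁.2)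
      (hxi A t₁ hA'A ht₁.1 ht₁.2) hφd
      (((continuous_growthRate s).const_smul M).add (Real.continuous_exp.const_smul ε)) ?_
    · have h0 : φ 0 = ε := by simp [hφ, growth_zero]
      rw [hxA, sub_zero, h0] at this
      have hb : φ (w t₁) ≤ |x t₁| := hbad
      simp only [hw] at hb
      linarith
    · filter_upwards [heq] with t ht htI
      have htm : t ∈ Icc A m := ⟨htI.1.le, htI.2.le.trans ht₁.2⟩
      refine ⟨_, ht ⟨hA'A.trans htm.1, htm.2⟩, ?_⟩
      rw [abs_neg, abs_mul]
      refine mul_le_mul_of_nonneg_left ?_ (abs_nonneg _)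
      change |x (τ t)| ≤ M * growthRate s (w t) + ε * Real.exp (w t)
      have hεe : 0 < ε * Real.exp (w t) := by positivity
      rcases lt_or_ge (τ t) A with hlt | hge
      · have hle1 := hM t ⟨hA'A.trans htm.1, htm.2⟩
        -- Going back from the zero `A` to `τ t` at speed at most `M`; the weight of `[τ t, A]` is
        -- at most `s` minus that of `[A, t]`.
        have hle2 : |x (τ t)| ≤ M * (s - w t) := by
          have h1 := abs_sub_le_mul_integral (c := c) (τ := τ) (x := x) (M := M) hlt.le
            (hci _ _ (hτ t htm) hlt.le hAm) (hxi _ _ (hτ t htm) hlt.le hAm)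
            (heq.mono fun r hr hrI ↦ hr ⟨(hτ t htm).trans hrI.1, hrI.2.trans hAm⟩)
            (fun r hr ↦ hM r ⟨(hτ t htm).trans hr.1, hr.2.trans hAm⟩)
          rw [hxA, zero_sub, abs_neg] at h1
          have h2 := intervalIntegral.integral_add_adjacent_intervals
            (hci _ _ (hτ t htm) hlt.le hAm).abs (hci A t hA'A htm.1 htm.2).abs
          have h3 := hsup t htm
          refine h1.trans (mul_le_mul_of_nonneg_left ?_ hM0)
          simp only [hw]
          linarith
        have : |x (τ t)| ≤ M * min 1 (s - w t) := by
          rw [mul_min_of_nonneg _ _ hM0]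
          exact le_min (by simpa using hle1) hle2
        have h4 : M * min 1 (s - w t) ≤ M * growthRate s (w t) :=
          mul_le_mul_of_nonneg_left (le_max_left _ _) hM0
        linarith
      · have h1 := hgood (τ t) hge ((hτt t htm).trans_lt htI.2)
        have h2 := hφm (hwmono (τ t) t hge (hτt t htm) htm.2)
        have h3 : M * growth s (w t) ≤ M * growthRate s (w t) :=
          mul_le_mul_of_nonneg_left (growth_le_growthRate hs) hM0
        have h4 : φ (w t) = M * growth s (w t) + ε * Real.exp (w t) := rfl
        linarith
  refine le_of_forall_pos_le_add fun δ hδ ↦ ?_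
  have := key (δ / Real.exp (w m)) (by positivity) m ⟨hAm, le_rfl⟩
  rw [div_mul_cancel₀ _ (Real.exp_pos _).ne'] at this
  exact this.le

/-- A nonzero value lies strictly between two consecutive zeros. -/
theorem exists_consecutive_zeros {x : ℝ → ℝ} {z t z' : ℝ} (hx : ContinuousOn x (Icc z z'))
    (hz : x z = 0) (hz' : x z' = 0) (ht : t ∈ Icc z z') (hxt : x t ≠ 0) :
    ∃ A B, z ≤ A ∧ A < t ∧ t < B ∧ B ≤ z' ∧ x A = 0 ∧ x B = 0 ∧ ∀ v ∈ Ioo A B, x v ≠ 0 := by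
  have hcl : ∀ p q, z ≤ p → q ≤ z' → IsCompact (Icc p q ∩ {v | x v = 0}) := by
    intro p q hp hq
    refine isCompact_Icc.of_isClosed_subset ?_ inter_subset_left
    exact (hx.mono (Icc_subset_Icc hp hq)).preimage_isClosed_of_isClosed isClosed_Icc
      isClosed_singleton
  obtain ⟨A, ⟨hA, hA0⟩, hAg⟩ := (hcl z t le_rfl ht.2).exists_isGreatest ⟨z, ⟨le_rfl, ht.1⟩, hz⟩
  obtain ⟨B, ⟨hB, hB0⟩, hBl⟩ := (hcl t z' ht.1 le_rfl).exists_isLeast ⟨z', ⟨ht.2, le_rfl⟩, hz'⟩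
  have hAt : A < t := lt_of_le_of_ne hA.2 fun h ↦ hxt (h ▸ hA0)
  have htB : t < B := lt_of_le_of_ne hB.1 fun h ↦ hxt (h ▸ hB0)
  refine ⟨A, B, hA.1, hAt, htB, hB.2, hA0, hB0, fun v hv hv0 ↦ ?_⟩
  rcases le_total v t with h | h
  · exact absurd (hAg ⟨⟨hA.1.trans hv.1.le, h⟩, hv0⟩) (not_le.mpr hv.1)
  · exact absurd (hBl ⟨⟨h, hv.2.le.trans hB.2⟩, hv0⟩) (not_le.mpr hv.2)

end DelayEq

namespace DelayEq

/-! ### Solutions of the delay equation. -/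

theorem IsData.intervalIntegrable {c τ : ℝ → ℝ} (h : IsData c τ) {a b : ℝ} (ha : 0 ≤ a)
    (hab : a ≤ b) : IntervalIntegrable c volume a b := by
  rw [intervalIntegrable_iff_integrableOn_Icc_of_le hab]
  exact (h.integrableOn b (ha.trans hab)).mono_set (Icc_subset_Icc_left ha)

theorem IsAdmissible.pos {τ : ℝ → ℝ} {ρ : ℝ} (h : IsAdmissible τ ρ) : 0 < ρ := by
  obtain ⟨t₁, -, -, h3⟩ := h
  exact (Real.sInf_nonneg fun t ht ↦ ht.1.le).trans_lt h3

theorem IsAdmissible.tauMin_le {c τ : ℝ → ℝ} {ρ t₀ t : ℝ} (hdata : IsData c τ)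
    (h : IsAdmissible τ ρ) (ht₀ : ρ ≤ t₀) (ht : t₀ ≤ t) : tauMin τ t₀ ≤ τ t := by
  obtain ⟨t₁, h1, -, h3⟩ := h
  have hne : {t : ℝ | 0 < t ∧ t₁ < tauMin τ t}.Nonempty := by
    obtain ⟨T, hT⟩ := eventually_atTop.mp (hdata.tendsto.eventually_ge_atTop (t₁ + 1))
    refine ⟨max T 1, lt_max_of_lt_right one_pos, (lt_add_one t₁).trans_le ?_⟩
    refine le_csInf (nonempty_Ici.image _) ?_
    rintro _ ⟨v, hv, rfl⟩
    exact hT v ((le_max_left _ _).trans hv)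
  obtain ⟨t₂, ⟨-, h5⟩, h6⟩ := exists_lt_of_csInf_lt hne h3
  -- An unbounded image would give `tauMin` the default value 0, which cannot exceed `t₁ ≥ 0`.
  have hbdd : BddBelow (τ '' Ici t₂) := by
    by_contra hb
    rw [tauMin, Real.sInf_of_not_bddBelow hb] at h5
    linarith
  exact csInf_le (hbdd.mono (image_mono (Ici_subset_Ici.mpr (h6.le.trans ht₀))))
    (mem_image_of_mem _ ht)

/-- The equation, on bounded intervals to the right of `t₀`. -/
theorem IsSolution.ae_hasDerivAt {c τ x : ℝ → ℝ} {t₀ a b : ℝ} (hx : IsSolution c τ t₀ x)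
    (ha : t₀ ≤ a) : ∀ᵐ t, t ∈ Icc a b → HasDerivAt x (-(c t * x (τ t))) t := by
  filter_upwards [(ae_restrict_iff' measurableSet_Ici).mp hx.equation] with t ht htab
  exact ht (ha.trans htab.1)

theorem IsSolution.absolutelyContinuous_of_le {c τ x : ℝ → ℝ} {t₀ a b : ℝ}
    (hx : IsSolution c τ t₀ x) (ha : tauMin τ t₀ ≤ a) (hab : a ≤ b) :
    AbsolutelyContinuousOnInterval x a b := by
  refine (hx.absolutelyContinuous b (ha.trans hab)).mono ?_
  rw [uIcc_of_le hab, uIcc_of_le (ha.trans hab)]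
  exact Icc_subset_Icc_left ha

theorem IsSolution.continuousOn {c τ x : ℝ → ℝ} {t₀ a b : ℝ}
    (hx : IsSolution c τ t₀ x) (ha : tauMin τ t₀ ≤ a) : ContinuousOn x (Icc a b) := by
  rcases le_or_gt a b with hab | hab
  · simpa [uIcc_of_le hab] using (hx.absolutelyContinuous_of_le ha hab).continuousOn
  · simp [Icc_eq_empty_of_lt hab]

/-- The increment of a solution whose delayed values are bounded by `M`. -/
theorem IsSolution.abs_sub_le {c τ x : ℝ → ℝ} {ρ t₀ a b M : ℝ} (hx : IsSolution c τ t₀ x)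
    (hdata : IsData c τ) (hρ : IsAdmissible τ ρ) (ht₀ : ρ ≤ t₀) (ha : t₀ ≤ a) (hab : a ≤ b)
    (hM : ∀ t ∈ Icc a b, |x (τ t)| ≤ M) : |x b - x a| ≤ M * ∫ u in a..b, |c u| := by
  have h0 := hρ.pos
  have h1 := (hρ.tauMin_le hdata ht₀ le_rfl).trans (hdata.le_self t₀ (by linarith))
  exact abs_sub_le_mul_integral hab (hdata.intervalIntegrable (by linarith) hab)
    (hx.absolutelyContinuous_of_le (by linarith) hab) (hx.ae_hasDerivAt ha) hM

/-- The growth of a solution after a zero `A`, when its delayed values are bounded by `M`. -/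
theorem IsSolution.abs_le_mul_growth {c τ x : ℝ → ℝ} {ρ s t₀ A' A m M : ℝ}
    (hx : IsSolution c τ t₀ x) (hdata : IsData c τ) (hρ : IsAdmissible τ ρ)
    (hs : s ∈ Icc (1 : ℝ) 2) (hsup : ∀ t : ℝ, ρ ≤ t → ∫ u in (τ t)..t, |c u| ≤ s)
    (ht₀ : ρ ≤ t₀) (hA' : t₀ ≤ A') (hA'A : A' ≤ A) (hAm : A ≤ m) (hM0 : 0 ≤ M)
    (hτ : ∀ t, A ≤ t → A' ≤ τ t) (hM : ∀ t ∈ Icc A' m, |x (τ t)| ≤ M) (hxA : x A = 0) :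
    |x m| ≤ M * growth s (∫ u in A..m, |c u|) := by
  have h0 := hρ.pos
  have h1 := (hρ.tauMin_le hdata ht₀ le_rfl).trans (hdata.le_self t₀ (by linarith))
  exact DelayEq.abs_le_mul_growth hs hA'A hAm hM0
    (hdata.intervalIntegrable (by linarith) (by linarith))
    (hx.absolutelyContinuous_of_le (by linarith) (by linarith)) (hx.ae_hasDerivAt hA')
    (fun t ht ↦ hτ t ht.1) (fun t ht ↦ hdata.le_self t (by linarith [ht.1])) hM
    (fun t ht ↦ hsup t (by linarith [ht.1])) hxA

/-! ### Boundedness and contraction. -/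

/-- From some time on, a bound on the history of a rapidly oscillating solution is preserved. -/
theorem IsSolution.exists_forall_abs_le {c τ x : ℝ → ℝ} {ρ s l t₀ : ℝ}
    (hx : IsSolution c τ t₀ x) (hdata : IsData c τ) (hρ : IsAdmissible τ ρ)
    (hs : s ∈ Icc (1 : ℝ) 2) (hsup : ∀ t : ℝ, ρ ≤ t → ∫ u in (τ t)..t, |c u| ≤ s)
    (hl : l ≤ Lam s) (ht₀ : ρ ≤ t₀) (hosc : IsRapidlyOscillating c l (tauMin τ t₀) x) :
    ∃ A₀, ∀ M > 0, (∀ t ∈ Icc (tauMin τ t₀) A₀, |x t| ≤ M) →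
      ∀ t, tauMin τ t₀ ≤ t → |x t| ≤ M := by
  have hρ0 := hρ.pos
  have htm := (hρ.tauMin_le hdata ht₀ le_rfl).trans (hdata.le_self t₀ (by linarith))
  obtain ⟨t₁, -, hint⟩ := hosc.integral_le
  obtain ⟨a₁, ha₁⟩ := eventually_atTop.mp (hdata.tendsto.eventually_ge_atTop t₀)
  obtain ⟨A₀, hA₀, -, hxA₀⟩ := hosc.zeros (max t₀ (max t₁ a₁))
  obtain ⟨hA₀0, hA₀1⟩ := max_le_iff.mp hA₀
  obtain ⟨hA₀1, hA₀2⟩ := max_le_iff.mp hA₀1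
  refine ⟨A₀, fun M hM hhist ↦ ?_⟩
  by_contra! hcon
  obtain ⟨t', ht'0, ht'M⟩ := hcon
  have ht'A : A₀ < t' := by
    by_contra! h
    exact absurd (hhist t' ⟨ht'0, h⟩) (not_le.mpr ht'M)
  set S : Set ℝ := {t | A₀ ≤ t ∧ M < |x t|} with hS
  have hSne : S.Nonempty := ⟨t', ht'A.le, ht'M⟩
  have hSb : BddBelow S := ⟨A₀, fun t ht ↦ ht.1⟩
  set p := sInf S with hp
  have hpA : A₀ ≤ p := le_csInf hSne fun t ht ↦ ht.1
  have hbefore : ∀ t, tauMin τ t₀ ≤ t → t < p → |x t| ≤ M := by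
    intro t h1 h2
    by_contra! h
    rcases le_total t A₀ with h3 | h3
    · exact absurd (hhist t ⟨h1, h3⟩) (not_le.mpr h)
    · exact absurd (csInf_le hSb ⟨h3, h⟩) (not_le.mpr h2)
  have hcontAt : ∀ t, t₀ < t → ContinuousAt x t := fun t ht ↦
    (hx.continuousOn (b := t + 1) htm).continuousAt (Icc_mem_nhds ht (lt_add_one t))
  have hcont : ContinuousOn x (Icc A₀ (t' + 1)) := hx.continuousOn (by linarith)
  have hpt' : p ≤ t' := csInf_le hSb ⟨ht'A.le, ht'M⟩
  have hxpge : M ≤ |x p| := by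
    have hmem : p ∈ closure (S ∩ Icc A₀ (t' + 1)) := by
      rw [Metric.mem_closure_iff]
      intro ε hε
      obtain ⟨r, hr, hrp⟩ := exists_lt_of_csInf_lt hSne (lt_add_of_pos_right p (lt_min hε one_pos))
      have hpr : p ≤ r := csInf_le hSb hr
      refine ⟨r, ⟨hr, hr.1, ?_⟩, ?_⟩
      · have := min_le_right ε 1
        linarith
      · rw [dist_comm, Real.dist_eq, abs_of_nonneg (by linarith)]
        have := min_le_left ε 1
        linarith
    have hcl : IsClosed (Icc A₀ (t' + 1) ∩ {t | M ≤ |x t|}) :=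
      isClosed_Icc.isClosed_le continuousOn_const hcont.abs
    have hsub : S ∩ Icc A₀ (t' + 1) ⊆ Icc A₀ (t' + 1) ∩ {t | M ≤ |x t|} :=
      fun t ht ↦ ⟨ht.2, ht.1.2.le⟩
    exact (closure_minimal hsub hcl hmem).2
  have hpA' : A₀ < p := by
    refine lt_of_le_of_ne hpA fun h ↦ ?_
    rw [← h, hxA₀, abs_zero] at hxpge
    linarith
  have hxp : |x p| ≤ M := by
    have hca : ContinuousWithinAt (fun t ↦ |x t|) (Iio p) p :=
      (hcontAt p (by linarith)).abs.continuousWithinAt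
    refine le_of_tendsto hca ?_
    filter_upwards [Ioo_mem_nhdsLT hpA'] with t ht
    exact hbefore t (by linarith [ht.1]) ht.2
  have hle : ∀ t, tauMin τ t₀ ≤ t → t ≤ p → |x t| ≤ M := by
    intro t h1 h2
    rcases h2.eq_or_lt with rfl | h2
    · exact hxp
    · exact hbefore t h1 h2
  obtain ⟨z, hzp, -, hxz⟩ := hosc.zeros p
  obtain ⟨A, B, hAA₀, hAp, hpB, -, hxA, hxB, hne⟩ := exists_consecutive_zeros (x := x) (t := p)
    (hx.continuousOn (by linarith)) hxA₀ hxz ⟨hpA, hzp⟩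
    (fun h ↦ by rw [h, abs_zero] at hxpge; linarith)
  have hAB := hint A B (hA₀1.trans hAA₀) (hAp.trans hpB) hne
  obtain ⟨m, hm, hmax⟩ := isCompact_Icc.exists_isMaxOn (nonempty_Icc.mpr (hAp.trans hpB).le)
    (hx.continuousOn (a := A) (b := B) (by linarith)).abs
  obtain ⟨r, hr, hrB⟩ := exists_lt_of_csInf_lt hSne hpB
  have hMm : M < |x m| :=
    hr.2.trans_le (hmax ⟨hAp.le.trans (csInf_le hSb hr), hrB.le⟩)
  have hpm : p < m := by
    by_contra! h
    exact absurd (hle m (by linarith [hm.1]) h) (not_le.mpr hMm)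
  have hdelay : ∀ t, t₀ ≤ t → t ≤ p → |x (τ t)| ≤ M := fun t h1 h2 ↦
    hle _ (hρ.tauMin_le hdata ht₀ h1) ((hdata.le_self t (by linarith)).trans h2)
  -- Past `p` the bound `M` is lost, but the maximum of the arc still bounds all delayed values up
  -- to `B`.
  have hdelay' : ∀ t, t₀ ≤ t → t ≤ B → |x (τ t)| ≤ |x m| := by
    intro t h1 h2
    have h3 := hdata.le_self t (by linarith)
    rcases le_total (τ t) p with h4 | h4
    · exact (hle _ (hρ.tauMin_le hdata ht₀ h1) h4).trans hMm.le
    · exact hmax ⟨hAp.le.trans h4, h3.trans h2⟩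
  have hgrow := hx.abs_le_mul_growth (A' := t₀) hdata hρ hs hsup ht₀ le_rfl (by linarith) hAp.le
    hM.le (fun t ht ↦ ha₁ t (by linarith)) (fun t ht ↦ hdelay t ht.1 ht.2) hxA
  have hI1 : Lam s - 1 ≤ ∫ u in A..p, |c u| := by
    rw [← (strictMono_growth hs.1).le_iff_le, growth_Lam_sub_one hs]
    by_contra! h
    nlinarith
  have hup := hx.abs_sub_le hdata hρ ht₀ (a := p) (b := m) (by linarith) hpm.le
    (fun t ht ↦ hdelay' t (by linarith [ht.1]) (ht.2.trans hm.2))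
  -- Strict positivity here settles the critical case `l = Lam s`: the three pieces of the arc weigh
  -- at least `Lam s - 1`, more than 0, and at least 1.
  have hI2 : 0 < ∫ u in p..m, |c u| := by
    have := abs_sub_abs_le_abs_sub (x m) (x p)
    by_contra! h
    nlinarith
  have hdown := hx.abs_sub_le hdata hρ ht₀ (a := m) (b := B) (by linarith) hm.2
    (fun t ht ↦ hdelay' t (by linarith [ht.1]) ht.2)
  rw [hxB, zero_sub, abs_neg] at hdown
  have hI3 : 1 ≤ ∫ u in m..B, |c u| := by
    by_contra! h
    nlinarith
  have e1 := intervalIntegral.integral_add_adjacent_intervals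
    (hdata.intervalIntegrable (a := A) (b := p) (by linarith) hAp.le).abs
    (hdata.intervalIntegrable (a := p) (b := m) (by linarith) hpm.le).abs
  have e2 := intervalIntegral.integral_add_adjacent_intervals
    (hdata.intervalIntegrable (a := A) (b := m) (by linarith) hm.1).abs
    (hdata.intervalIntegrable (a := m) (b := B) (by linarith [hm.1]) hm.2).abs
  linarith

/-- Below the critical length, eventual bounds contract by a fixed factor. -/
theorem IsSolution.exists_contraction {c τ x : ℝ → ℝ} {ρ s l t₀ : ℝ}
    (hx : IsSolution c τ t₀ x) (hdata : IsData c τ) (hρ : IsAdmissible τ ρ)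
    (hs : s ∈ Icc (1 : ℝ) 2) (hsup : ∀ t : ℝ, ρ ≤ t → ∫ u in (τ t)..t, |c u| ≤ s)
    (hl : l < Lam s) (ht₀ : ρ ≤ t₀) (hosc : IsRapidlyOscillating c l (tauMin τ t₀) x) :
    ∃ q, 0 < q ∧ q < 1 ∧ ∀ M > 0, (∀ᶠ t in atTop, |x t| ≤ M) →
      ∀ᶠ t in atTop, |x t| ≤ q * M := by
  have hρ0 := hρ.pos
  have htm := (hρ.tauMin_le hdata ht₀ le_rfl).trans (hdata.le_self t₀ (by linarith))
  set η := (Lam s - l) / 2 with hη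
  have hη0 : 0 < η := by rw [hη]; linarith
  have hg1 : growth s (Lam s - 1 - η) < 1 := by
    have := strictMono_growth hs.1 (show Lam s - 1 - η < Lam s - 1 by linarith)
    rwa [growth_Lam_sub_one hs] at this
  -- The first two entries force weight above `Lam s - 1 - η` before, and above `1 - η` after, any
  -- value larger than `q * M`; the total exceeds `Lam s - 2η = l`. The entry `1 / 2` only keeps `q`
  -- positive.
  set q := max (growth s (Lam s - 1 - η)) (max (1 - η) (1 / 2)) with hq
  have hqg : growth s (Lam s - 1 - η) ≤ q := le_max_left _ _
  have hqη : 1 - η ≤ q := (le_max_left _ _).trans (le_max_right _ _)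
  have hq2 : 1 / 2 ≤ q := (le_max_right _ _).trans (le_max_right _ _)
  refine ⟨q, by linarith, max_lt hg1 (max_lt (by linarith) (by norm_num)), fun M hM hev ↦ ?_⟩
  obtain ⟨T, hT⟩ := eventually_atTop.mp hev
  obtain ⟨a₁, ha₁⟩ := eventually_atTop.mp (hdata.tendsto.eventually_ge_atTop T)
  set A' := max t₀ a₁ with hA'
  have hA't₀ : t₀ ≤ A' := le_max_left _ _
  have hA'a₁ : a₁ ≤ A' := le_max_right _ _
  -- The delay is controlled twice: the growth bound also estimates `x` between `τ t` and `A`, where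
  -- the delayed values must again be at most `M`.
  obtain ⟨a₂, ha₂⟩ := eventually_atTop.mp (hdata.tendsto.eventually_ge_atTop A')
  obtain ⟨t₁, -, hint⟩ := hosc.integral_le
  obtain ⟨A₀, hA₀, -, hxA₀⟩ := hosc.zeros (max A' (max t₁ a₂))
  obtain ⟨hA₀0, hA₀1⟩ := max_le_iff.mp hA₀
  obtain ⟨hA₀1, hA₀2⟩ := max_le_iff.mp hA₀1
  have hdelay : ∀ t, A' ≤ t → |x (τ t)| ≤ M := fun t ht ↦ hT _ (ha₁ t (hA'a₁.trans ht))
  filter_upwards [eventually_ge_atTop A₀] with t ht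
  by_contra! hcon
  obtain ⟨z, hzt, -, hxz⟩ := hosc.zeros t
  have hqM : 0 < q * M := mul_pos (by linarith) hM
  obtain ⟨A, B, hAA₀, hAt, htB, -, hxA, hxB, hne⟩ := exists_consecutive_zeros (x := x) (t := t)
    (hx.continuousOn (by linarith)) hxA₀ hxz ⟨ht, hzt⟩
    (fun h ↦ by rw [h, abs_zero] at hcon; linarith)
  have hAB := hint A B (hA₀1.trans hAA₀) (hAt.trans htB) hne
  have hgrow := hx.abs_le_mul_growth hdata hρ hs hsup ht₀ hA't₀ (by linarith) hAt.le
    hM.le (fun r hr ↦ ha₂ r (by linarith)) (fun r hr ↦ hdelay r hr.1) hxA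
  have hI1 : Lam s - 1 - η < ∫ u in A..t, |c u| := by
    rw [← (strictMono_growth hs.1).lt_iff_lt]
    by_contra! h
    nlinarith
  have hdown := hx.abs_sub_le hdata hρ ht₀ (a := t) (b := B) (by linarith) htB.le
    (fun r hr ↦ hdelay r (by linarith [hr.1]))
  rw [hxB, zero_sub, abs_neg] at hdown
  have hI2 : 1 - η < ∫ u in t..B, |c u| := by
    by_contra! h
    nlinarith
  have e1 := intervalIntegral.integral_add_adjacent_intervals
    (hdata.intervalIntegrable (a := A) (b := t) (by linarith) hAt.le).abs
    (hdata.intervalIntegrable (a := t) (b := B) (by linarith) htB.le).abs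
  linarith

end DelayEq

theorem theorem20p56 (c τ : ℝ → ℝ) (hdata : DelayEq.IsData c τ)
    (ρ : ℝ) (hρ : DelayEq.IsAdmissible τ ρ)
    (s : ℝ) (hs : s ∈ Set.Icc (1 : ℝ) 2)
    (hsup : ∀ t : ℝ, ρ ≤ t → ∫ u in (τ t)..t, |c u| ≤ s)
    (l : ℝ) (hl : l ≤ DelayEq.Lam s)
    (t₀ : ℝ) (ht₀ : ρ ≤ t₀) (x : ℝ → ℝ)
    (hx : DelayEq.IsSolution c τ t₀ x)
    (hosc : DelayEq.IsRapidlyOscillating c l (DelayEq.tauMin τ t₀) x) :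
    (∃ M : ℝ, ∀ t : ℝ, DelayEq.tauMin τ t₀ ≤ t → |x t| ≤ M) ∧
      (l < DelayEq.Lam s → Tendsto x atTop (𝓝 0)) := by
  obtain ⟨M, hM, hbound⟩ : ∃ M > 0, ∀ t : ℝ, DelayEq.tauMin τ t₀ ≤ t → |x t| ≤ M := by
    obtain ⟨A₀, hA₀⟩ := hx.exists_forall_abs_le hdata hρ hs hsup hl ht₀ hosc
    obtain ⟨C, hC⟩ := isCompact_Icc.exists_bound_of_continuousOn
      (hx.continuousOn (b := A₀) le_rfl)
    refine ⟨max C 1, lt_max_of_lt_right one_pos, hA₀ _ (lt_max_of_lt_right one_pos) fun t ht ↦ ?_⟩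
    exact (hC t ht).trans (le_max_left _ _)
  refine ⟨⟨M, hbound⟩, fun hlt ↦ ?_⟩
  obtain ⟨q, hq0, hq1, hcontr⟩ := hx.exists_contraction hdata hρ hs hsup hlt ht₀ hosc
  have hpow : ∀ n : ℕ, ∀ᶠ t in atTop, |x t| ≤ q ^ n * M := by
    intro n
    induction n with
    | zero => filter_upwards [eventually_ge_atTop (DelayEq.tauMin τ t₀)] with t ht
              simpa using hbound t ht
    | succ n ih => simpa [pow_succ', mul_assoc] using hcontr _ (by positivity) ih
  rw [Metric.tendsto_nhds]
  intro ε hε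
  have hlim : Tendsto (fun n : ℕ ↦ q ^ n * M) atTop (𝓝 0) := by
    simpa using (tendsto_pow_atTop_nhds_zero_of_lt_one hq0.le hq1).mul_const M
  obtain ⟨n, hn⟩ := (hlim.eventually_lt_const hε).exists
  filter_upwards [hpow n] with t ht
  rw [dist_zero_right, Real.norm_eq_abs]
  exact ht.trans_lt hn
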